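/- Let $\mathfrak{S}_n$ be the set of permutations of $\{1,\dots,n\}$, written in one-line notation $\pi=\pi_1\cdots\pi_n$. A permutation $\pi\in\mathfrak{S}_n$ contains $\rho\in\mathfrak{S}_k$ as a pattern if there are indices $i_1<\cdots<i_k$ such that the sequence $\pi_{i_1}\cdots\pi_{i_k}$ is in the same relative order as $\rho_1\cdots\rho_k$; otherwise $\pi$ avoids $\rho$. For a set $P$ of permutations, $\mathrm{Av}_n(P)$ denotes the set of all $\pi\in\mathfrak{S}_n$ that avoid every element of $P$. Two sets $P,Q$ of permutations are Wilf-equivalent if $\#\mathrm{Av}_n(P)=\#\mathrm{Av}_n(Q)$ for all $n$. For integers $a\ge1$, $b\ge0$ with $a+b\ge2$, the partial shuffle $\Pi(a,b)\subseteq\mathfrak{S}_{a+b}$ is the set of permutations obtained by writing the elements of $\{1,\dots,a+b\}\setminus\{a\}$ in increasing order and inserting $a$ at any position except the one that gives the increasing permutation. Let $\delta_m=m\,(m-1)\cdots 1$ be the decreasing permutation of size $m$. Theorem. Let $a,b,c,d,m$ be integers with $a,c\ge1$, $b,d\ge0$, $a+b=c+d\ge2$ and $m\ge1$. Then the sets of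 patterns $\Pi(a,b)\cup\{\delta_m\}$ and $\Pi(c,d)\cup\{\delta_m\}$ are Wilf-equivalent. -/

import Mathlib

namespace PatternAvoidance

/-- A pattern: a permutation `ρ` of some size `k`, in one-line notation
`ρ 0, ρ 1, …, ρ (k - 1)` (positions and values are numbered from `0`). -/
abbrev Pattern : Type := Σ k : ℕ, Equiv.Perm (Fin k)

/-- `π` contains `ρ`: at some positions `f 0 < f 1 < ⋯ < f (k - 1)` the entries of `π`
are in the same relative order as the entries of `ρ`. -/
def Contains {n k : ℕ} (π : Equiv.Perm (Fin n)) (ρ : Equiv.Perm (Fin k)) : Prop :=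
  ∃ f : Fin k → Fin n, StrictMono f ∧ ∀ i j : Fin k, π (f i) < π (f j) ↔ ρ i < ρ j

/-- `Av n P` is the set of permutations of size `n` that avoid every pattern in `P`. -/
def Av (n : ℕ) (P : Set Pattern) : Set (Equiv.Perm (Fin n)) :=
  {π | ∀ ρ ∈ P, ¬ Contains π ρ.2}

/-- Two sets of patterns are Wilf-equivalent if, for every `n`, they are avoided by equally
many permutations of size `n`. -/
def WilfEquivalent (P Q : Set Pattern) : Prop :=
  ∀ n : ℕ, (Av n P).ncard = (Av n Q).ncard

/-- The decreasing permutation of size `m`. -/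
def decreasing (m : ℕ) : Pattern := ⟨m, Fin.revPerm⟩

/-- A permutation of size `a + b` belongs to the partial shuffle `Π(a, b)` when the values
other than the `a`-th smallest one (which is `a - 1` in `Fin (a + b)`) occur in increasing order
from left to right, and it is not the increasing permutation. -/
def IsPartialShuffle (a b : ℕ) (ρ : Equiv.Perm (Fin (a + b))) : Prop :=
  (∀ i j : Fin (a + b), i < j → (ρ i : ℕ) + 1 ≠ a → (ρ j : ℕ) + 1 ≠ a → ρ i < ρ j) ∧ ρ ≠ 1

/-- The partial shuffle `Π(a, b)`, as a set of patterns of size `a + b`. -/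
def partialShuffle (a b : ℕ) : Set Pattern :=
  {p | ∃ ρ : Equiv.Perm (Fin (a + b)), IsPartialShuffle a b ρ ∧ p = ⟨a + b, ρ⟩}

end PatternAvoidance

/-!
The number `π k` is the value of the entry in position `k` of `π`. A permutation avoids `Π(i + 1,
j)`, where `i + j > 0`, exactly when it is tight (`Tight`): if `v`, `y` are consecutive terms of an
increasing sequence with `i` terms up to `v` and `j` terms from `y` on, then the entries with
values between those of `v` and `y` have positions between them. To treat empty sequences like the
others, permutations are padded with a least entry in front and a greatest one at the end (`pad`);
then "`i` terms up to `v`" becomes "`i` padded terms before `v`", and so on.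

The heart is an injection from avoiders of `Π(s + 1, t + 1)` to avoiders of `Π(s + 2, t)`. Call an
entry heavy if, in the padded permutation, increasing sequences have more than `s` terms before it
and more than `t` terms after it. Each heavy `x` lies, in position and value, between two light
(that is, not heavy) entries: `lower x`, of least value among the entries to the left that have `s`
terms before them, and `upper x`, of greatest value among the entries to the right that have `t`
terms after them. Tightness for `(s, t + 1)` says that every heavy value sits just above that of
its `lower` (`Tight.lt_iff_lower`). Raise it to just below that of its `upper` instead (`IsLift`),
keeping all positions. Chains through heavy entries can be rerouted through `lower` and `upper`, so
the sets of heavy entries and of light entries with long chains do not change (`reach_congr`).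
Hence the result is tight for `(s + 1, t)` (`IsLift.tight`), and the original can be recovered from
it, because `lower` is the same for both (`IsLift.lower_eq`). Moreover no longer decreasing
sequence arises (`IsLift.exists_strictAntiOn`).

So the number of permutations avoiding `Π(i + 1, j)` and the decreasing pattern is weakly
increasing in `i` for fixed `i + j`. The reverse-complement exchanges `(i, j)` with `(j, i)`, so
the first and the last of these numbers agree, and all of them are equal.
-/

namespace PatternAvoidance

open Finset

/-! ### Chains and the lift of the heavy entries -/

section Chains

variable {V W W' : Type*}

/-- `Reach r i v`: there is a chain `v₁, v₂, …, vᵢ, v` of consecutively `r`-related elements, with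
`i` elements before `v`. -/
def Reach (r : V → V → Prop) : ℕ → V → Prop
  | 0, _ => True
  | i + 1, v => ∃ u, r u v ∧ Reach r i u

theorem Reach.anti {r : V → V → Prop} {i j : ℕ} {v : V} (h : Reach r j v) (hij : i ≤ j) :
    Reach r i v := by
  induction i generalizing j v with
  | zero => trivial
  | succ i ih =>
    obtain ⟨j, rfl⟩ : ∃ k, j = k + 1 := ⟨j - 1, by omega⟩
    obtain ⟨u, hu, h⟩ := h
    exact ⟨u, hu, ih h (by omega)⟩

/-- Two transitive relations have the same chains of length at most `n + 1` if they agree off a set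
`H` each of whose elements has, for both relations, a predecessor outside `H` that already ends a
chain of length `n`: such a predecessor can stand in for any element of `H` in a chain. -/
theorem reach_congr {r r' : V → V → Prop} (hr : ∀ u v w, r u v → r v w → r u w)
    (hr' : ∀ u v w, r' u v → r' v w → r' u w) {H : V → Prop} {n : ℕ}
    (hagree : ∀ u w, ¬ H u → ¬ H w → (r u w ↔ r' u w))
    (hH : ∀ x, H x → ∃ z, ¬ H z ∧ r z x ∧ r' z x ∧ Reach r n z) {i : ℕ} (hi : i ≤ n + 1) (u : V) :
    Reach r i u ↔ Reach r' i u := by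
  induction i generalizing u with
  | zero => exact Iff.rfl
  | succ i ih =>
    have ih := ih (by omega)
    by_cases hu : H u
    · obtain ⟨z, -, h1, h2, h3⟩ := hH u hu
      have h4 : Reach r i z := h3.anti (by omega)
      exact ⟨fun _ => ⟨z, h2, (ih z).1 h4⟩, fun _ => ⟨z, h1, h4⟩⟩
    · constructor
      · rintro ⟨w, hw, h⟩
        by_cases hw' : H w
        · obtain ⟨z, hz, h1, -, h3⟩ := hH w hw'
          exact ⟨z, (hagree z u hz hu).1 (hr _ _ _ h1 hw), (ih z).1 (h3.anti (by omega))⟩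
        · exact ⟨w, (hagree w u hw' hu).1 hw, (ih w).1 h⟩
      · rintro ⟨w, hw, h⟩
        by_cases hw' : H w
        · obtain ⟨z, hz, -, h2, h3⟩ := hH w hw'
          exact ⟨z, (hagree z u hz hu).2 (hr' _ _ _ h2 hw), h3.anti (by omega)⟩
        · exact ⟨w, (hagree w u hw' hu).2 hw, (ih w).2 h⟩

variable [LinearOrder V] [LinearOrder W] [LinearOrder W']

/-- `u` lies to the lower left of `v` in the plot of `p`. -/
def Below (p : V → W) (u v : V) : Prop := u < v ∧ p u < p v

theorem Below.trans {p : V → W} {u v w : V} (h : Below p u v) (h' : Below p v w) : Below p u w :=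
  ⟨h.1.trans h'.1, h.2.trans h'.2⟩

/-- Some increasing sequence of `p` ends at `v` and has `i` entries before `v`. -/
abbrev Rises (p : V → W) : ℕ → V → Prop := Reach (Below p)

/-- Some increasing sequence of `p` starts at `v` and has `j` entries after `v`. -/
abbrev Climbs (p : V → W) : ℕ → V → Prop := Reach (flip (Below p))

/-- Whenever an increasing sequence has `v` and `y` as consecutive terms, with at least `i` terms
before `v` and at least `j` after `y`, every entry whose value lies between those of `v` and `y`
also has its position between them. For a permutation padded with a least entry in front and a
greatest one at the end, this is avoidance of the partial shuffle `Π(i + 1, j)`, if `i + j > 0`. -/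
def Tight (p : V → W) (i j : ℕ) : Prop :=
  ∀ v y, Below p v y → Rises p i v → Climbs p j y → ∀ u, p v < p u → p u < p y → v < u ∧ u < y

/-- The entries that are moved: those with more than `s` terms before and more than `t` terms after
them in increasing sequences. -/
def Heavy (p : V → W) (s t : ℕ) (x : V) : Prop := Rises p (s + 1) x ∧ Climbs p (t + 1) x

variable {p : V → W} {p' : V → W'} {s t : ℕ}

theorem exists_upper [Finite V] {x : V} (hx : Heavy p s t x) :
    ∃ y, (x < y ∧ Climbs p t y) ∧ ∀ w, x < w → Climbs p t w → p w ≤ p y := by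
  obtain ⟨y, hy, h⟩ := hx.2
  obtain ⟨m, hm, hmax⟩ := Set.exists_max_image {w | x < w ∧ Climbs p t w} p (Set.toFinite _)
    ⟨y, hy.1, h⟩
  exact ⟨m, hm, fun w h1 h2 => hmax w ⟨h1, h2⟩⟩

theorem exists_lower [Finite V] {x : V} (hx : Heavy p s t x) :
    ∃ z, (z < x ∧ Rises p s z) ∧ ∀ w, w < x → Rises p s w → p z ≤ p w := by
  obtain ⟨y, hy, h⟩ := hx.1
  obtain ⟨m, hm, hmax⟩ := Set.exists_min_image {w | w < x ∧ Rises p s w} p (Set.toFinite _)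
    ⟨y, hy.1, h⟩
  exact ⟨m, hm, fun w h1 h2 => hmax w ⟨h1, h2⟩⟩

open Classical in
/-- For a heavy `x`, the entry of greatest value among those to the right of `x` that start an
increasing sequence with `t` further terms; a fixed point at the other entries. -/
noncomputable def upper [Finite V] (p : V → W) (s t : ℕ) (u : V) : V :=
  if h : Heavy p s t u then (exists_upper h).choose else u

open Classical in
/-- For a heavy `x`, the entry of least value among those to the left of `x` that end an increasing
sequence with `s` earlier terms; a fixed point at the other entries. -/
noncomputable def lower [Finite V] (p : V → W) (s t : ℕ) (u : V) : V :=
  if h : Heavy p s t u then (exists_lower h).choose else u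

variable [Finite V]

theorem upper_of_not_heavy {u : V} (h : ¬ Heavy p s t u) : upper p s t u = u := by
  simp [upper, h]

theorem lower_of_not_heavy {u : V} (h : ¬ Heavy p s t u) : lower p s t u = u := by
  simp [lower, h]

theorem upper_spec {x : V} (h : Heavy p s t x) :
    (x < upper p s t x ∧ Climbs p t (upper p s t x)) ∧
      ∀ w, x < w → Climbs p t w → p w ≤ p (upper p s t x) := by
  simpa [upper, h] using (exists_upper h).choose_spec

theorem lower_spec {x : V} (h : Heavy p s t x) :
    (lower p s t x < x ∧ Rises p s (lower p s t x)) ∧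
      ∀ w, w < x → Rises p s w → p (lower p s t x) ≤ p w := by
  simpa [lower, h] using (exists_lower h).choose_spec

theorem below_upper {x : V} (h : Heavy p s t x) : Below p x (upper p s t x) := by
  obtain ⟨y, hy, h'⟩ := h.2
  exact ⟨(upper_spec h).1.1, hy.2.trans_le ((upper_spec h).2 y hy.1 h')⟩

theorem lower_below {x : V} (h : Heavy p s t x) : Below p (lower p s t x) x := by
  obtain ⟨y, hy, h'⟩ := h.1
  exact ⟨(lower_spec h).1.1, ((lower_spec h).2 y hy.1 h').trans_lt hy.2⟩

theorem not_heavy_upper (u : V) : ¬ Heavy p s t (upper p s t u) := by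
  by_cases h : Heavy p s t u
  · rintro ⟨-, y, hy, h'⟩
    exact absurd hy.2 (not_lt.2 ((upper_spec h).2 y ((upper_spec h).1.1.trans hy.1) h'))
  · rwa [upper_of_not_heavy h]

theorem not_heavy_lower (u : V) : ¬ Heavy p s t (lower p s t u) := by
  by_cases h : Heavy p s t u
  · rintro ⟨⟨y, hy, h'⟩, -⟩
    exact absurd hy.2 (not_lt.2 ((lower_spec h).2 y (hy.1.trans (lower_spec h).1.1) h'))
  · rwa [lower_of_not_heavy h]

theorem le_apply_upper (u : V) : p u ≤ p (upper p s t u) := by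
  by_cases h : Heavy p s t u
  · exact (below_upper h).2.le
  · rw [upper_of_not_heavy h]

theorem apply_lower_le (u : V) : p (lower p s t u) ≤ p u := by
  by_cases h : Heavy p s t u
  · exact (lower_below h).2.le
  · rw [lower_of_not_heavy h]

/-- `p'` orders the entries as `p` does, except that the value of each heavy entry `x` is raised to
just below that of `upper x`; heavy entries raised to the same place are put in increasing order. The
same tie-break by position puts `x` below `upper x`, as `x < upper x` and `upper` fixes `upper x`. -/
def IsLift (p : V → W) (s t : ℕ) (p' : V → W') : Prop :=
  ∀ u w, p' u < p' w ↔ p (upper p s t u) < p (upper p s t w) ∨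
    upper p s t u = upper p s t w ∧ u < w

/-- In a tight configuration the value of each heavy entry `x` is already just above that of
`lower x`, so the order of values can be read off from the light entries and `lower`. -/
theorem Tight.lt_iff_lower (hT : Tight p s (t + 1)) (hp : p.Injective) (u w : V) :
    p u < p w ↔ p (lower p s t u) < p (lower p s t w) ∨
      lower p s t u = lower p s t w ∧ u < w := by
  have key : ∀ u w, p u < p w → p (lower p s t u) < p (lower p s t w) ∨
      lower p s t u = lower p s t w ∧ u < w := by
    intro u w huw
    by_cases hw : Heavy p s t w
    · rcases le_or_gt (p u) (p (lower p s t w)) with h | h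
      · rcases lt_or_eq_of_le ((apply_lower_le (s := s) (t := t) u).trans h) with h1 | h1
        · exact .inl h1
        · have h2 : u = lower p s t w :=
            hp (le_antisymm h (h1 ▸ apply_lower_le (s := s) (t := t) u))
          exact .inr ⟨hp h1, h2 ▸ (lower_below hw).1⟩
      · obtain ⟨h1, h2⟩ := hT _ _ (lower_below hw) (lower_spec hw).1.2 hw.2 u h huw
        have hu : Heavy p s t u :=
          ⟨⟨_, ⟨h1, h⟩, (lower_spec hw).1.2⟩, ⟨w, ⟨h2, huw⟩, hw.2.anti (by omega)⟩⟩
        rcases lt_or_eq_of_le ((lower_spec hu).2 _ h1 (lower_spec hw).1.2) with h3 | h3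
        · exact .inl h3
        · exact .inr ⟨hp h3, h2⟩
    · rw [lower_of_not_heavy hw]
      exact .inl ((apply_lower_le u).trans_lt huw)
  refine ⟨key u w, fun h => ?_⟩
  by_contra h'
  rcases lt_or_eq_of_le (not_lt.1 h') with h1 | h1
  · rcases h with h | h <;> rcases key _ _ h1 with h2 | h2
    · exact lt_asymm h h2
    · exact h.ne (by rw [h2.1])
    · exact h2.ne (by rw [h.1])
    · exact lt_asymm h.2 h2.2
  · obtain rfl := hp h1
    simp at h

namespace IsLift

theorem lt_iff (h : IsLift p s t p') {u w : V} (hu : ¬ Heavy p s t u) (hw : ¬ Heavy p s t w) :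
    p' u < p' w ↔ p u < p w := by
  rw [h, upper_of_not_heavy hu, upper_of_not_heavy hw]
  constructor
  · rintro (h | ⟨rfl, h⟩)
    · exact h
    · exact absurd h (lt_irrefl _)
  · exact .inl

theorem lt_of_lt (h : IsLift p s t p') {u w : V} (hu : ¬ Heavy p s t u) (huw : p u < p w) :
    p' u < p' w := by
  rw [h, upper_of_not_heavy hu]
  exact .inl (huw.trans_le (le_apply_upper w))

theorem rises_iff (h : IsLift p s t p') {i : ℕ} (hi : i ≤ s + 1) (u : V) :
    Rises p i u ↔ Rises p' i u := by
  refine reach_congr (fun _ _ _ => Below.trans) (fun _ _ _ => Below.trans) (H := Heavy p s t)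
    (fun u w hu hw => and_congr_right fun _ => (h.lt_iff hu hw).symm) (fun x hx => ?_) hi u
  exact ⟨lower p s t x, not_heavy_lower x, lower_below hx,
    ⟨(lower_below hx).1, h.lt_of_lt (not_heavy_lower x) (lower_below hx).2⟩, (lower_spec hx).1.2⟩

theorem climbs_iff (h : IsLift p s t p') {i : ℕ} (hi : i ≤ t + 1) (u : V) :
    Climbs p i u ↔ Climbs p' i u := by
  refine reach_congr (r := flip (Below p)) (r' := flip (Below p'))
    (fun _ _ _ h h' => Below.trans h' h) (fun _ _ _ h h' => Below.trans h' h)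
    (H := Heavy p s t)
    (fun u w hu hw => by simp only [flip, Below, h.lt_iff hw hu]) (fun x hx => ?_) hi u
  refine ⟨upper p s t x, not_heavy_upper x, below_upper hx,
    ⟨(below_upper hx).1, (h _ _).2 (.inr ⟨?_, (below_upper hx).1⟩)⟩, (upper_spec hx).1.2⟩
  exact (upper_of_not_heavy (not_heavy_upper x)).symm

theorem heavy_iff (h : IsLift p s t p') (u : V) : Heavy p s t u ↔ Heavy p' s t u :=
  and_congr (h.rises_iff le_rfl u) (h.climbs_iff le_rfl u)

/-- Only `v` heavy and `upper y = upper v` are possible in the definition of `Tight p' (s + 1) t`, and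
between two entries with the same `upper` there are only further ones, in increasing order. -/
theorem tight (h : IsLift p s t p') : Tight p' (s + 1) t := by
  intro v y hvy hv hy u hvu huy
  rw [← h.rises_iff le_rfl] at hv
  rw [← h.climbs_iff (by omega)] at hy
  have hy' : Climbs p t (upper p s t y) := by
    by_cases h1 : Heavy p s t y
    · exact (upper_spec h1).1.2
    · rwa [upper_of_not_heavy h1]
  have hlt : v < upper p s t y := by
    by_cases h1 : Heavy p s t y
    · exact hvy.1.trans (below_upper h1).1
    · rw [upper_of_not_heavy h1]; exact hvy.1
  have hvh : Heavy p s t v := by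
    by_contra hvh
    rcases (h _ _).1 hvy.2 with h1 | h1
    · rw [upper_of_not_heavy hvh] at h1
      exact hvh ⟨hv, _, ⟨hlt, h1⟩, hy'⟩
    · rw [upper_of_not_heavy hvh] at h1
      exact hlt.ne h1.1
  have h1 := (upper_spec hvh).2 _ hlt hy'
  have h2 := (h _ _).1 hvu
  have h3 := (h _ _).1 huy
  have h4 : p (upper p s t v) ≤ p (upper p s t u) := by
    rcases h2 with h2 | h2
    exacts [h2.le, by rw [h2.1]]
  have h5 : p (upper p s t u) ≤ p (upper p s t y) := by
    rcases h3 with h3 | h3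
    exacts [h3.le, by rw [h3.1]]
  exact ⟨(h2.resolve_left (not_lt.2 (h5.trans h1))).2, (h3.resolve_left (not_lt.2 (h1.trans h4))).2⟩

/-- The map `lower` survives the lift; together with `Tight.lt_iff_lower` this makes the lift
invertible. -/
theorem lower_eq (h : IsLift p s t p') (hp' : p'.Injective) : lower p s t = lower p' s t := by
  funext u
  by_cases hu : Heavy p s t u
  · have hu' := (h.heavy_iff u).1 hu
    obtain ⟨⟨h1, h2⟩, h3⟩ := lower_spec hu
    obtain ⟨⟨h1', h2'⟩, h3'⟩ := lower_spec hu'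
    rw [h.rises_iff (by omega)] at h2
    refine hp' (le_antisymm (not_lt.1 fun hlt => ?_) (h3' _ h1 h2))
    rw [← h.rises_iff (by omega)] at h2'
    rcases lt_or_eq_of_le (h3 _ h1' h2') with h4 | h4
    · exact lt_asymm hlt (h.lt_of_lt (not_heavy_lower u) h4)
    · rw [h, upper_of_not_heavy (not_heavy_lower u), h4,
        upper_of_not_heavy (mt (h.heavy_iff _).1 (not_heavy_lower u))] at hlt
      rcases hlt with hlt | hlt
      · exact lt_irrefl _ hlt
      · exact lt_irrefl _ (hlt.1 ▸ hlt.2)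
  · rw [lower_of_not_heavy hu, lower_of_not_heavy (mt (h.heavy_iff u).2 hu)]

theorem lt_iff_lower (h : IsLift p s t p') (hp : p.Injective) (hp' : p'.Injective)
    (hT : Tight p s (t + 1)) (u w : V) :
    p u < p w ↔ p' (lower p' s t u) < p' (lower p' s t w) ∨
      lower p' s t u = lower p' s t w ∧ u < w := by
  rw [hT.lt_iff_lower hp, ← h.lower_eq hp', h.lt_iff (not_heavy_lower u) (not_heavy_lower w)]

/-- A decreasing sequence `D` of `p'` yields one of `p` of the same length: a heavy `x ∈ D` is kept if
some element of `D` has its position strictly between `x` and `upper x`, and is replaced by `upper x`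
otherwise. -/
theorem exists_strictAntiOn (h : IsLift p s t p') {D : Finset V}
    (hD : StrictAntiOn p' D) : ∃ E : Finset V, E.card = D.card ∧ StrictAntiOn p E := by
  classical
  set Y := upper p s t with hY
  have lt_upper : ∀ x ∈ D, ∀ x' ∈ D, Heavy p s t x → Heavy p s t x' → x < x' →
      Y x < x' ∧ p (Y x') < p (Y x) := by
    intro x hx x' hx' hH hH' hlt
    have h1 : p (Y x') < p (Y x) := by
      rcases (h _ _).1 (hD hx hx' hlt) with h1 | h1
      exacts [h1, absurd h1.2 (lt_asymm hlt)]
    refine ⟨lt_of_not_ge fun h2 => ?_, h1⟩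
    rcases lt_or_eq_of_le h2 with h2 | h2
    · exact absurd h1 (not_lt.2 ((upper_spec hH').2 _ h2 (upper_spec hH).1.2))
    · exact not_heavy_upper x (h2 ▸ hH')
  -- A heavy `q` is excluded by `lt_upper`. A light `q` has increasing sequences of `t + 1` terms
  -- after it, through `Y x`, so it cannot also lie above `lower x`: its value is less than `p x`.
  have between : ∀ x ∈ D, ∀ q ∈ D, Heavy p s t x → x < q → q < Y x →
      ¬ Heavy p s t q ∧ p q < p x := by
    intro x hx q hq hH hxq hqY
    have hq' : ¬ Heavy p s t q := fun hHq => lt_asymm hqY (lt_upper x hx q hq hH hHq hxq).1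
    refine ⟨hq', lt_of_not_ge fun hle => hq' ⟨?_, ?_⟩⟩
    · exact ⟨_, ⟨(lower_below hH).1.trans hxq, (lower_below hH).2.trans_le hle⟩,
        (lower_spec hH).1.2⟩
    · have h1 := (h _ _).1 (hD hx hq hxq)
      rw [upper_of_not_heavy hq'] at h1
      exact ⟨_, ⟨hqY, h1.resolve_right fun h2 => lt_asymm hxq h2.2⟩, (upper_spec hH).1.2⟩
  let φ : V → V := fun x => if ∃ q ∈ D, x < q ∧ q < Y x then x else Y x
  have hφ : ∀ x, φ x = x ∨ φ x = Y x := fun x => by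
    by_cases hc : ∃ q ∈ D, x < q ∧ q < Y x <;> simp [φ, hc]
  have hφn : ∀ x, ¬ Heavy p s t x → φ x = x := fun x hx => by
    rcases hφ x with h1 | h1
    exacts [h1, h1.trans (upper_of_not_heavy hx)]
  have main : ∀ x ∈ D, ∀ g ∈ D, x < g → φ x < φ g ∧ p (φ g) < p (φ x) := by
    intro x hx g hg hxg
    have hlt := (h _ _).1 (hD hx hg hxg)
    replace hlt := hlt.resolve_right fun h2 => lt_asymm hxg h2.2
    by_cases hH : Heavy p s t x <;> by_cases hHg : Heavy p s t g
    · obtain ⟨h1, h2⟩ := lt_upper x hx g hg hH hHg hxg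
      have h3 : g ≤ φ g := by
        rcases hφ g with h3 | h3 <;> rw [h3]
        exact (below_upper hHg).1.le
      have h4 : p (φ g) ≤ p (Y g) := by
        rcases hφ g with h3 | h3 <;> rw [h3]
        exact (below_upper hHg).2.le
      by_cases hc : ∃ q ∈ D, x < q ∧ q < Y x
      · have hx1 : φ x = x := if_pos hc
        obtain ⟨q, hq, hxq, hqY⟩ := hc
        obtain ⟨hqn, hqx⟩ := between x hx q hq hH hxq hqY
        rw [hx1]
        refine ⟨hxg.trans_le h3, h4.trans_lt (lt_of_le_of_lt ?_ hqx)⟩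
        have := (h _ _).1 (hD hq hg (hqY.trans h1))
        rw [upper_of_not_heavy hqn] at this
        rcases this with h5 | h5
        exacts [h5.le, by rw [← h5.1]]
      · have hx1 : φ x = Y x := if_neg hc
        rw [hx1]
        exact ⟨h1.trans_le h3, h4.trans_lt h2⟩
    · rw [hφn g hHg]
      rw [upper_of_not_heavy hHg] at hlt
      by_cases hc : ∃ q ∈ D, x < q ∧ q < Y x
      · have hx1 : φ x = x := if_pos hc
        obtain ⟨q, hq, hxq, hqY⟩ := hc
        obtain ⟨hqn, hqx⟩ := between x hx q hq hH hxq hqY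
        rw [hx1]
        refine ⟨hxg, ?_⟩
        rcases lt_or_ge q g with h1 | h1
        · exact ((h.lt_iff hHg hqn).1 (hD hq hg h1)).trans hqx
        · exact (between x hx g hg hH hxg (h1.trans_lt hqY)).2
      · have hx1 : φ x = Y x := if_neg hc
        rw [hx1]
        refine ⟨lt_of_le_of_ne (not_lt.1 fun h1 => hc ⟨g, hg, hxg, h1⟩) ?_, hlt⟩
        rintro rfl
        exact lt_irrefl _ hlt
    · rw [hφn x hH]
      rw [upper_of_not_heavy hH] at hlt
      rcases hφ g with h3 | h3 <;> rw [h3]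
      · exact ⟨hxg, (below_upper hHg).2.trans hlt⟩
      · exact ⟨hxg.trans (below_upper hHg).1, hlt⟩
    · rw [hφn x hH, hφn g hHg]
      rw [upper_of_not_heavy hH, upper_of_not_heavy hHg] at hlt
      exact ⟨hxg, hlt⟩
  have hmono : StrictMonoOn φ D := fun x hx g hg hxg => (main x hx g hg hxg).1
  refine ⟨D.image φ, Finset.card_image_of_injOn hmono.injOn, ?_⟩
  rw [Finset.coe_image]
  rintro _ ⟨x, hx, rfl⟩ _ ⟨g, hg, rfl⟩ hxg
  exact (main x hx g hg ((hmono.lt_iff_lt hx hg).1 hxg)).2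

end IsLift
end Chains

/-! ### Partial shuffles and decreasing patterns as subsequences -/

theorem exists_perm_lt_iff {k : ℕ} {K : Type*} [LinearOrder K] (g : Fin k → K)
    (hg : g.Injective) : ∃ ρ : Equiv.Perm (Fin k), ∀ i j, ρ i < ρ j ↔ g i < g j := by
  have h : StrictMono (g ∘ Tuple.sort g) :=
    (Tuple.monotone_sort g).strictMono_of_injective (hg.comp (Tuple.sort g).injective)
  refine ⟨(Tuple.sort g)⁻¹, fun i j => ?_⟩
  rw [← h.lt_iff_lt]
  simp

theorem perm_eq_of_lt_iff {n : ℕ} {π σ : Equiv.Perm (Fin n)}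
    (h : ∀ i j, π i < π j ↔ σ i < σ j) : π = σ := by
  have h1 : StrictMono fun x => σ (π.symm x) := fun x y hxy => by
    rw [← h]; simpa using hxy
  have h2 := Subsingleton.elim (h1.orderIsoOfSurjective _ (σ.surjective.comp π.symm.surjective))
    (OrderIso.refl _)
  ext i
  have := DFunLike.congr_fun h2 (π i)
  simp at this
  rw [this]

/-- There are an increasing subsequence `C` of `π` with `i + j` entries and one more entry `u` whose
value exceeds exactly `i` of those in `C`, but which is not inserted in the place that would make
`C ∪ {u}` increasing. This is containment of a pattern in `Π(i + 1, j)`. -/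
def HasShuffle {n : ℕ} (i j : ℕ) (π : Equiv.Perm (Fin n)) : Prop :=
  ∃ (C : Finset (Fin n)) (u : Fin n), StrictMonoOn π C ∧ u ∉ C ∧
    #{c ∈ C | π c < π u} = i ∧ #{c ∈ C | π u < π c} = j ∧ ∃ c ∈ C, ¬ (c < u ↔ π c < π u)

/-- `π` has a decreasing subsequence of length `m`. -/
def HasDecreasing {n : ℕ} (m : ℕ) (π : Equiv.Perm (Fin n)) : Prop :=
  ∃ D : Finset (Fin n), #D = m ∧ StrictAntiOn π D

theorem contains_decreasing_iff {n m : ℕ} (π : Equiv.Perm (Fin n)) :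
    Contains π (decreasing m).2 ↔ HasDecreasing m π := by
  change Contains π (Fin.revPerm : Equiv.Perm (Fin m)) ↔ _
  constructor
  · rintro ⟨f, hf, h⟩
    refine ⟨univ.image f, (card_image_of_injective _ hf.injective).trans (card_fin m), ?_⟩
    simp only [coe_image, coe_univ, Set.image_univ]
    rintro _ ⟨i, rfl⟩ _ ⟨j, rfl⟩ hij
    exact (h j i).2 (Fin.rev_lt_rev.2 (hf.lt_iff_lt.1 hij))
  · rintro ⟨D, hD, h⟩
    refine ⟨D.orderEmbOfFin hD, (D.orderEmbOfFin hD).strictMono, fun i j => ?_⟩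
    rw [h.lt_iff_gt (by simp) (by simp), (D.orderEmbOfFin hD).lt_iff_lt]
    exact Fin.rev_lt_rev.symm

theorem HasShuffle.of_contains {n i b : ℕ} {π : Equiv.Perm (Fin n)}
    {ρ : Equiv.Perm (Fin (i + 1 + b))} (hρ : IsPartialShuffle (i + 1) b ρ) (h : Contains π ρ) :
    HasShuffle i b π := by
  obtain ⟨f, hf, h⟩ := h
  obtain ⟨hρ, hne⟩ := hρ
  set x₀ := ρ.symm ⟨i, by omega⟩ with hx₀
  have hx : ρ x₀ = ⟨i, by omega⟩ := by simp [hx₀]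
  have hval : ∀ k, k ≠ x₀ → (ρ k : ℕ) + 1 ≠ i + 1 := fun k hk h' =>
    hk (ρ.injective (by rw [hx]; ext; simpa using h'))
  -- `ρ` carries the indices other than `x₀` to the values other than `ρ x₀`.
  have hcard : ∀ (q : Fin n → Prop) (q' : Fin (i + 1 + b) → Prop) [DecidablePred q]
      [DecidablePred q'], (∀ k, q (f k) ↔ q' (ρ k)) → ¬ q' (ρ x₀) →
      #{c ∈ (univ.erase x₀).image f | q c} = #{c | q' c} := by
    intro q q' _ _ hq hn
    rw [filter_image, card_image_of_injective _ hf.injective]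
    refine card_bij (fun k _ => ρ k) ?_ (fun _ _ _ _ h => ρ.injective h) ?_
    · simp [hq]
    · intro c hc
      refine ⟨ρ.symm c, ?_, by simp⟩
      simp only [mem_filter, mem_univ, true_and] at hc
      simp only [mem_filter, mem_erase, mem_univ, and_true, hq, Equiv.apply_symm_apply, hc]
      intro h'
      exact hn (by rw [← h']; simpa using hc)
  refine ⟨(univ.erase x₀).image f, f x₀, ?_, ?_, ?_, ?_, ?_⟩
  · intro c hc d hd hcd
    simp only [coe_image, Set.mem_image, mem_coe, mem_erase, mem_univ, and_true] at hc hd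
    obtain ⟨k, hk, rfl⟩ := hc
    obtain ⟨l, hl, rfl⟩ := hd
    rw [h]
    exact hρ k l (hf.lt_iff_lt.1 hcd) (hval k hk) (hval l hl)
  · simp [hf.injective.eq_iff]
  · rw [hcard (fun c => π c < π (f x₀)) (fun c => c < ρ x₀) (fun k => h _ _) (lt_irrefl _), hx]
    have : ({c | c < ⟨i, by omega⟩} : Finset (Fin (i + 1 + b))) = Iio ⟨i, by omega⟩ := by
      ext; simp
    rw [this, Fin.card_Iio]
  · rw [hcard (fun c => π (f x₀) < π c) (fun c => ρ x₀ < c) (fun k => h _ _) (lt_irrefl _), hx]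
    have : ({c | ⟨i, by omega⟩ < c} : Finset (Fin (i + 1 + b))) = Ioi ⟨i, by omega⟩ := by
      ext; simp
    rw [this, Fin.card_Ioi]
    grind
  · by_contra hcon
    push Not at hcon
    have hcon : ∀ k, k ≠ x₀ → (k < x₀ ↔ ρ k < ρ x₀) := fun k hk => by
      have := hcon (f k) (mem_image_of_mem _ (by simpa using hk))
      rwa [hf.lt_iff_lt, h] at this
    refine hne (perm_eq_of_lt_iff fun k l => ?_)
    have hmono : StrictMono ρ := by
      intro k l hkl
      by_cases hk : k = x₀
      · subst hk
        have h1 := (hcon l hkl.ne').not.1 (lt_asymm hkl)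
        exact lt_of_le_of_ne (not_lt.1 h1) (ρ.injective.ne hkl.ne)
      · by_cases hl : l = x₀
        · subst hl; exact (hcon k hk).1 hkl
        · exact hρ k l hkl (hval k hk) (hval l hl)
    rw [hmono.lt_iff_lt]; rfl

theorem HasShuffle.exists_contains {n i b : ℕ} {π : Equiv.Perm (Fin n)} (h : HasShuffle i b π) :
    ∃ ρ : Equiv.Perm (Fin (i + 1 + b)), IsPartialShuffle (i + 1) b ρ ∧ Contains π ρ := by
  obtain ⟨C, u, hC, hu, hi, hb, c, hc, hcu⟩ := h
  have hcard : #(insert u C) = i + 1 + b := by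
    rw [card_insert_of_notMem hu, ← hi, ← hb,
      ← card_filter_add_card_filter_not (s := C) (fun c => π c < π u)]
    have : {c ∈ C | ¬ π c < π u} = {c ∈ C | π u < π c} := filter_congr fun c hc => by
      rw [not_lt, le_iff_lt_or_eq, or_iff_left]
      exact fun h => hu (π.injective h ▸ hc)
    rw [this]; omega
  set f := (insert u C).orderEmbOfFin hcard
  have hmem : ∀ k, f k ∈ insert u C := fun k => orderEmbOfFin_mem _ hcard k
  have hsurj : ∀ c ∈ insert u C, ∃ k, f k = c := fun c hc => by
    have : c ∈ Set.range f := by rw [range_orderEmbOfFin]; exact hc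
    exact this
  obtain ⟨ρ, hρ⟩ := exists_perm_lt_iff (π ∘ f) (π.injective.comp f.injective)
  obtain ⟨x₀, hx₀⟩ := hsurj u (mem_insert_self _ _)
  have hval : (ρ x₀ : ℕ) = i := by
    refine (Fin.card_Iio (ρ x₀)).symm.trans (Eq.trans (Eq.symm ?_) hi)
    refine card_bij' (fun c hc => ρ (hsurj c (mem_insert_of_mem (mem_filter.1 hc).1)).choose)
      (fun k _ => f (ρ.symm k)) ?_ ?_ ?_ ?_
    · intro c hc
      have := (hsurj c (mem_insert_of_mem (mem_filter.1 hc).1)).choose_spec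
      rw [mem_Iio, hρ, Function.comp, Function.comp, this, hx₀]
      exact (mem_filter.1 hc).2
    · intro k hk
      have h1 : π (f (ρ.symm k)) < π u := by
        rw [← hx₀]
        exact (hρ _ _).1 (by simpa using hk)
      refine mem_filter.2 ⟨(mem_insert.1 (hmem (ρ.symm k))).resolve_left fun h2 => ?_, h1⟩
      rw [h2] at h1
      exact lt_irrefl _ h1
    · intro c hc
      have := (hsurj c (mem_insert_of_mem (mem_filter.1 hc).1)).choose_spec
      simpa using this
    · intro k hk
      rw [← Equiv.eq_symm_apply]
      exact f.injective (hsurj _ (hmem _)).choose_spec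
  have hfC : ∀ k, (ρ k : ℕ) + 1 ≠ i + 1 → f k ∈ C := fun k hk =>
    (mem_insert.1 (hmem k)).resolve_left fun h => hk (by
      rw [← hx₀] at h; rw [f.injective h, hval])
  refine ⟨ρ, ⟨fun k l hkl hk hl => ?_, ?_⟩, f, f.strictMono, fun k l => (hρ k l).symm⟩
  · rw [hρ]
    exact hC (hfC k hk) (hfC l hl) (f.strictMono hkl)
  · rintro rfl
    obtain ⟨k, rfl⟩ := hsurj c (mem_insert_of_mem hc)
    refine hcu ?_
    rw [← hx₀, f.lt_iff_lt]
    exact hρ k x₀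

theorem mem_av_iff {n i b m : ℕ} (π : Equiv.Perm (Fin n)) :
    π ∈ Av n (partialShuffle (i + 1) b ∪ {decreasing m}) ↔
      ¬ HasShuffle i b π ∧ ¬ HasDecreasing m π := by
  rw [← contains_decreasing_iff]
  constructor
  · refine fun h => ⟨fun h' => ?_, h _ (.inr rfl)⟩
    obtain ⟨ρ, h1, h2⟩ := h'.exists_contains
    exact h ⟨_, ρ⟩ (.inl ⟨ρ, h1, rfl⟩) h2
  · rintro ⟨h1, h2⟩ _ (⟨ρ, hρ, rfl⟩ | rfl)
    · exact fun h => h1 (.of_contains hρ h)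
    · exact h2

section ReverseComplement

variable {n : ℕ}

/-- The reverse-complement of `π`, which rotates its plot by a half turn. -/
def reverseComplement (π : Equiv.Perm (Fin n)) : Equiv.Perm (Fin n) :=
  Fin.revPerm * π * Fin.revPerm

theorem reverseComplement_apply (π : Equiv.Perm (Fin n)) (k : Fin n) :
    reverseComplement π k = (π k.rev).rev := rfl

theorem reverseComplement_involutive :
    Function.Involutive (reverseComplement : Equiv.Perm (Fin n) → _) := fun π => by
  ext; simp [reverseComplement_apply]

theorem HasShuffle.reverseComplement {i j : ℕ} {π : Equiv.Perm (Fin n)} (h : HasShuffle i j π) :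
    HasShuffle j i (reverseComplement π) := by
  obtain ⟨C, u, hC, hu, hi, hj, c, hc, hcu⟩ := h
  refine ⟨C.map Fin.revPerm.toEmbedding, u.rev, ?_, ?_, ?_, ?_, c.rev, ?_, ?_⟩
  · intro x hx y hy hxy
    simp only [coe_map, Set.mem_image, mem_coe] at hx hy
    obtain ⟨x, hx, rfl⟩ := hx
    obtain ⟨y, hy, rfl⟩ := hy
    simp only [reverseComplement_apply] at hxy ⊢
    simp at hxy ⊢
    exact hC hy hx hxy
  · simpa using hu
  · rw [filter_map, card_map, ← hj]
    congr 1
    ext; simp [reverseComplement_apply]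
  · rw [filter_map, card_map, ← hi]
    congr 1
    ext; simp [reverseComplement_apply]
  · simpa using hc
  · simp only [reverseComplement_apply, Fin.rev_rev, Fin.rev_lt_rev]
    have h1 : c ≠ u := fun h => hu (h ▸ hc)
    have h2 : π c ≠ π u := π.injective.ne h1
    rcases lt_or_gt_of_ne h1 with h1 | h1 <;> rcases lt_or_gt_of_ne h2 with h2 | h2 <;>
      simp_all [lt_asymm]

theorem HasDecreasing.reverseComplement {m : ℕ} {π : Equiv.Perm (Fin n)}
    (h : HasDecreasing m π) : HasDecreasing m (reverseComplement π) := by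
  obtain ⟨D, hm, hD⟩ := h
  refine ⟨D.map Fin.revPerm.toEmbedding, by simpa using hm, ?_⟩
  intro x hx y hy hxy
  simp only [coe_map, Set.mem_image, mem_coe] at hx hy
  obtain ⟨x, hx, rfl⟩ := hx
  obtain ⟨y, hy, rfl⟩ := hy
  simp only [reverseComplement_apply] at hxy ⊢
  simp at hxy ⊢
  exact hD hy hx hxy

end ReverseComplement

/-- The permutations of size `n` that avoid `Π(i + 1, j)` and the decreasing permutation of size `m`
(`mem_av_iff`). -/
def avoiders (n m i j : ℕ) : Set (Equiv.Perm (Fin n)) :=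
  {π | ¬ HasShuffle i j π ∧ ¬ HasDecreasing m π}

theorem ncard_avoiders_swap (n m i j : ℕ) :
    (avoiders n m i j).ncard ≤ (avoiders n m j i).ncard := by
  refine Set.ncard_le_ncard_of_injOn reverseComplement
    (fun π h => ⟨fun h' => h.1 ?_, fun h' => h.2 ?_⟩)
    reverseComplement_involutive.injective.injOn (Set.toFinite _)
  · simpa [reverseComplement_involutive π] using h'.reverseComplement
  · simpa [reverseComplement_involutive π] using h'.reverseComplement

/-! ### Padded permutations and the comparison of the numbers of avoiders -/

section Padding

variable {n : ℕ}

/-- The entries of a permutation among those of its padding. -/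
abbrev entry (k : Fin n) : WithBot (WithTop (Fin n)) := ((k : WithTop (Fin n)) :)

/-- `π` with a new least value `⊥` in a new first position `⊥`, and a new greatest value `⊤` in a new
last position `⊤`. These serve as ends of empty increasing sequences, so that `lower` and `upper`
exist even when `s = 0` or `t = 0`. -/
def pad (π : Equiv.Perm (Fin n)) : WithBot (WithTop (Fin n)) → WithBot (WithTop (Fin n)) :=
  WithBot.map (WithTop.map π)

variable (π : Equiv.Perm (Fin n))

theorem pad_bot : pad π ⊥ = ⊥ := rfl

theorem pad_top : pad π ⊤ = ⊤ := rfl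

theorem pad_entry (k : Fin n) : pad π (entry k) = entry (π k) := rfl

theorem entry_injective : (entry : Fin n → WithBot (WithTop (Fin n))).Injective :=
  WithBot.coe_injective.comp WithTop.coe_injective

theorem pad_injective : (pad π).Injective :=
  WithBot.map_injective (WithTop.map_injective π.injective)

theorem pad_cases {P : WithBot (WithTop (Fin n)) → Prop} (bot : P ⊥) (top : P ⊤)
    (coe : ∀ k : Fin n, P (entry k)) (v) : P v := by
  induction v with
  | bot => exact bot
  | coe v =>
    induction v with
    | top => exact top
    | coe k => exact coe k

theorem exists_pad_lt_iff {K : Type*} [LinearOrder K] (g : WithBot (WithTop (Fin n)) → K)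
    (hg : g.Injective) (hbot : ∀ v, g ⊥ ≤ g v) (htop : ∀ v, g v ≤ g ⊤) :
    ∃ π : Equiv.Perm (Fin n), ∀ u v, pad π u < pad π v ↔ g u < g v := by
  obtain ⟨π, hπ⟩ := exists_perm_lt_iff (fun k : Fin n => g (entry k))
    (hg.comp entry_injective)
  have hb : ∀ v, v ≠ ⊥ → g ⊥ < g v := fun v hv => lt_of_le_of_ne (hbot v) (hg.ne hv.symm)
  have ht : ∀ v, v ≠ ⊤ → g v < g ⊤ := fun v hv => lt_of_le_of_ne (htop v) (hg.ne hv)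
  have hb' : ∀ v, v ≠ ⊥ → pad π ⊥ < pad π v := fun v hv =>
    bot_lt_iff_ne_bot.2 ((pad_injective π).ne hv)
  have ht' : ∀ v, v ≠ ⊤ → pad π v < pad π ⊤ := fun v hv =>
    lt_top_iff_ne_top.2 ((pad_injective π).ne hv)
  refine ⟨π, fun u v => ?_⟩
  by_cases hub : u = ⊥
  · subst hub
    by_cases hv : v = ⊥
    · subst hv; simp
    · exact iff_of_true (hb' v hv) (hb v hv)
  by_cases hvb : v = ⊥
  · subst hvb
    exact iff_of_false (hb' u hub).not_gt (hb u hub).not_gt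
  by_cases hvt : v = ⊤
  · subst hvt
    by_cases hu : u = ⊤
    · subst hu; simp
    · exact iff_of_true (ht' u hu) (ht u hu)
  by_cases hut : u = ⊤
  · subst hut
    exact iff_of_false (ht' v hvt).not_gt (ht v hvt).not_gt
  induction u using pad_cases with
  | bot => exact absurd rfl hub
  | top => exact absurd rfl hut
  | coe k =>
    induction v using pad_cases with
    | bot => exact absurd rfl hvb
    | top => exact absurd rfl hvt
    | coe l => simpa [pad_entry] using hπ k l

variable {π}

theorem exists_lift (π : Equiv.Perm (Fin n)) (s t : ℕ) :
    ∃ π' : Equiv.Perm (Fin n), IsLift (pad π) s t (pad π') := by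
  have hb : ¬ Heavy (pad π) s t ⊥ := fun ⟨⟨u, hu, _⟩, _⟩ => not_lt_bot hu.1
  have ht : ¬ Heavy (pad π) s t ⊤ := fun ⟨_, u, hu, _⟩ => not_top_lt hu.1
  obtain ⟨π', h⟩ := exists_pad_lt_iff (fun u => toLex (pad π (upper (pad π) s t u), u))
    (fun u v h => congrArg Prod.snd (toLex.injective h))
    (fun v => by
      rw [upper_of_not_heavy hb, Prod.Lex.toLex_le_toLex', pad_bot]
      exact ⟨bot_le, fun _ => bot_le⟩)
    (fun v => by
      rw [upper_of_not_heavy ht, Prod.Lex.toLex_le_toLex', pad_top]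
      exact ⟨le_top, fun _ => le_top⟩)
  refine ⟨π', fun u w => (h u w).trans ?_⟩
  simp only [Prod.Lex.toLex_lt_toLex, (pad_injective π).eq_iff]

theorem Rises.exists_finset {i : ℕ} {v : WithBot (WithTop (Fin n))} (h : Rises (pad π) i v)
    (hv : v ≠ ⊤) : ∃ C : Finset (Fin n), #C = i ∧ StrictMonoOn π C ∧
      (∀ c ∈ C, entry c ≤ v ∧ pad π (entry c) ≤ pad π v) ∧ (i ≠ 0 → ∃ c ∈ C, entry c = v) := by
  induction i generalizing v with
  | zero => exact ⟨∅, by simp [StrictMonoOn]⟩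
  | succ i ih =>
    obtain ⟨u, hu, h⟩ := h
    obtain ⟨C, h1, h2, h3, -⟩ := ih h (ne_top_of_lt hu.1)
    induction v using pad_cases with
    | bot => exact absurd hu.1 not_lt_bot
    | top => exact absurd rfl hv
    | coe k =>
      have h4 : ∀ c ∈ C, c < k ∧ π c < π k := fun c hc => by
        have h5 := (h3 c hc).1.trans_lt hu.1
        have h6 := (h3 c hc).2.trans_lt hu.2
        simpa [pad_entry] using And.intro h5 h6
      have hk : k ∉ C := fun hk => lt_irrefl _ (h4 k hk).1
      refine ⟨insert k C, by rw [card_insert_of_notMem hk, h1], ?_, ?_, fun _ => ⟨k, by simp⟩⟩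
      · rw [coe_insert]
        rintro x (rfl | hx) y (rfl | hy) hxy
        · exact absurd hxy (lt_irrefl _)
        · exact absurd hxy (h4 y hy).1.not_gt
        · exact (h4 x hx).2
        · exact h2 hx hy hxy
      · intro c hc
        rcases mem_insert.1 hc with rfl | hc
        · exact ⟨le_rfl, le_rfl⟩
        · exact ⟨(h3 c hc).1.trans hu.1.le, (h3 c hc).2.trans hu.2.le⟩

theorem Climbs.exists_finset {i : ℕ} {v : WithBot (WithTop (Fin n))} (h : Climbs (pad π) i v)
    (hv : v ≠ ⊥) : ∃ C : Finset (Fin n), #C = i ∧ StrictMonoOn π C ∧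
      (∀ c ∈ C, v ≤ entry c ∧ pad π v ≤ pad π (entry c)) ∧ (i ≠ 0 → ∃ c ∈ C, entry c = v) := by
  induction i generalizing v with
  | zero => exact ⟨∅, by simp [StrictMonoOn]⟩
  | succ i ih =>
    obtain ⟨u, hu, h⟩ := h
    obtain ⟨C, h1, h2, h3, -⟩ := ih h (ne_bot_of_gt hu.1)
    induction v using pad_cases with
    | bot => exact absurd rfl hv
    | top => exact absurd hu.1 not_top_lt
    | coe k =>
      have h4 : ∀ c ∈ C, k < c ∧ π k < π c := fun c hc => by
        have h5 := hu.1.trans_le (h3 c hc).1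
        have h6 := hu.2.trans_le (h3 c hc).2
        simpa [pad_entry] using And.intro h5 h6
      have hk : k ∉ C := fun hk => lt_irrefl _ (h4 k hk).1
      refine ⟨insert k C, by rw [card_insert_of_notMem hk, h1], ?_, ?_, fun _ => ⟨k, by simp⟩⟩
      · rw [coe_insert]
        rintro x (rfl | hx) y (rfl | hy) hxy
        · exact absurd hxy (lt_irrefl _)
        · exact (h4 y hy).2
        · exact absurd hxy (h4 x hx).1.not_gt
        · exact h2 hx hy hxy
      · intro c hc
        rcases mem_insert.1 hc with rfl | hc
        · exact ⟨le_rfl, le_rfl⟩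
        · exact ⟨hu.1.le.trans (h3 c hc).1, hu.2.le.trans (h3 c hc).2⟩

theorem exists_rises (C : Finset (Fin n)) (hC : StrictMonoOn π C) :
    ∃ v, Rises (pad π) #C v ∧ (v = ⊥ ∨ ∃ c ∈ C, v = entry c) ∧
      ∀ c ∈ C, entry c ≤ v ∧ pad π (entry c) ≤ pad π v := by
  induction C using Finset.induction_on_max with
  | empty => exact ⟨⊥, trivial, .inl rfl, by simp⟩
  | insert a C ha ih =>
    have hlt : ∀ c ∈ C, π c < π a := fun c hc => hC (by simp [hc]) (by simp) (ha c hc)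
    obtain ⟨v, h1, h2, -⟩ := ih (hC.mono (by simp))
    refine ⟨entry a, ?_, .inr ⟨a, by simp, rfl⟩, ?_⟩
    · rw [card_insert_of_notMem fun h => lt_irrefl _ (ha a h)]
      refine ⟨v, ?_, h1⟩
      rcases h2 with rfl | ⟨c, hc, rfl⟩
      · exact ⟨WithBot.bot_lt_coe _, WithBot.bot_lt_coe _⟩
      · exact ⟨by simpa using ha c hc, by simpa [pad_entry] using hlt c hc⟩
    · intro c hc
      rcases mem_insert.1 hc with rfl | hc
      · exact ⟨le_rfl, le_rfl⟩
      · exact ⟨by simpa using (ha c hc).le, by simpa [pad_entry] using (hlt c hc).le⟩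

theorem exists_climbs (C : Finset (Fin n)) (hC : StrictMonoOn π C) :
    ∃ v, Climbs (pad π) #C v ∧ (v = ⊤ ∨ ∃ c ∈ C, v = entry c) ∧
      ∀ c ∈ C, v ≤ entry c ∧ pad π v ≤ pad π (entry c) := by
  induction C using Finset.induction_on_min with
  | empty => exact ⟨⊤, trivial, .inl rfl, by simp⟩
  | insert a C ha ih =>
    have hlt : ∀ c ∈ C, π a < π c := fun c hc => hC (by simp) (by simp [hc]) (ha c hc)
    obtain ⟨v, h1, h2, -⟩ := ih (hC.mono (by simp))
    refine ⟨entry a, ?_, .inr ⟨a, by simp, rfl⟩, ?_⟩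
    · rw [card_insert_of_notMem fun h => lt_irrefl _ (ha a h)]
      refine ⟨v, ?_, h1⟩
      rcases h2 with rfl | ⟨c, hc, rfl⟩
      · exact ⟨WithBot.coe_lt_coe.2 (WithTop.coe_lt_top _),
          WithBot.coe_lt_coe.2 (WithTop.coe_lt_top _)⟩
      · exact ⟨by simpa using ha c hc, by simpa [pad_entry] using hlt c hc⟩
    · intro c hc
      rcases mem_insert.1 hc with rfl | hc
      · exact ⟨le_rfl, le_rfl⟩
      · exact ⟨by simpa using (ha c hc).le, by simpa [pad_entry] using (hlt c hc).le⟩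

theorem Tight.not_hasShuffle {i j : ℕ} (hT : Tight (pad π) i j) : ¬ HasShuffle i j π := by
  rintro ⟨C, u, hC, hu, rfl, rfl, c, hc, hcu⟩
  obtain ⟨v, hv, hv', hvC⟩ := exists_rises {c ∈ C | π c < π u}
    (hC.mono (coe_subset.2 (filter_subset _ _)))
  obtain ⟨y, hy, hy', hyC⟩ := exists_climbs {c ∈ C | π u < π c}
    (hC.mono (coe_subset.2 (filter_subset _ _)))
  have hvu : pad π v < pad π (entry u) := by
    rcases hv' with rfl | ⟨c, hc, rfl⟩
    · exact WithBot.bot_lt_coe _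
    · simpa [pad_entry] using (mem_filter.1 hc).2
  have huy : pad π (entry u) < pad π y := by
    rcases hy' with rfl | ⟨c, hc, rfl⟩
    · exact WithBot.coe_lt_coe.2 (WithTop.coe_lt_top _)
    · simpa [pad_entry] using (mem_filter.1 hc).2
  have hlt : v < y := by
    rcases hv' with rfl | ⟨c, hc, rfl⟩ <;> rcases hy' with rfl | ⟨d, hd, rfl⟩
    · exact WithBot.bot_lt_coe _
    · exact WithBot.bot_lt_coe _
    · exact WithBot.coe_lt_coe.2 (WithTop.coe_lt_top _)
    · rw [mem_filter] at hc hd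
      simpa using (hC.lt_iff_lt hc.1 hd.1).1 (hc.2.trans hd.2)
  obtain ⟨h1, h2⟩ := hT v y ⟨hlt, hvu.trans huy⟩ hv hy _ hvu huy
  have hne : π c ≠ π u := fun h => hu (π.injective h ▸ hc)
  rcases lt_or_gt_of_ne hne with h | h
  · have h3 := (hvC c (mem_filter.2 ⟨hc, h⟩)).1.trans_lt h1
    exact hcu (iff_of_true (by simpa using h3) h)
  · have h3 := h2.trans_le (hyC c (mem_filter.2 ⟨hc, h⟩)).1
    exact hcu (iff_of_false (lt_asymm (by simpa using h3)) (lt_asymm h))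

/-- For `i = 0` nothing is said about `v`, as the increasing sequence witnessing `Rises (pad π) 0 v`
need not contain `v`; likewise for `j = 0` and `y`. -/
theorem lt_of_not_hasShuffle {i j : ℕ} (hS : ¬ HasShuffle i j π) {v y u : WithBot (WithTop (Fin n))}
    (hvy : Below (pad π) v y) (hv : Rises (pad π) i v) (hy : Climbs (pad π) j y)
    (hvu : pad π v < pad π u) (huy : pad π u < pad π y) : (i ≠ 0 → v < u) ∧ (j ≠ 0 → u < y) := by
  obtain ⟨C, hCi, hC, hCv, hvC⟩ := hv.exists_finset (ne_top_of_lt hvy.1)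
  obtain ⟨D, hDj, hD, hDy, hyD⟩ := hy.exists_finset (ne_bot_of_gt hvy.1)
  induction u using pad_cases with
  | bot => exact absurd hvu not_lt_bot
  | top => exact absurd huy not_top_lt
  | coe u =>
    have hCu : ∀ c ∈ C, π c < π u := fun c hc => by
      simpa [pad_entry] using (hCv c hc).2.trans_lt hvu
    have hDu : ∀ d ∈ D, π u < π d := fun d hd => by
      simpa [pad_entry] using huy.trans_le (hDy d hd).2
    have hCD : ∀ c ∈ C, ∀ d ∈ D, c < d := fun c hc d hd => by
      simpa using ((hCv c hc).1.trans_lt hvy.1).trans_le (hDy d hd).1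
    have hall : ∀ c ∈ C ∪ D, (c < u ↔ π c < π u) := by
      by_contra hall
      rw [not_forall₂] at hall
      refine hS ⟨C ∪ D, u, ?_, ?_, ?_, ?_, by simpa only [exists_prop] using hall⟩
      · rw [coe_union]
        rintro a (ha | ha) b (hb | hb) hab
        · exact hC ha hb hab
        · exact (hCu a ha).trans (hDu b hb)
        · exact absurd hab (hCD b hb a ha).not_gt
        · exact hD ha hb hab
      · intro h
        rcases mem_union.1 h with h | h
        exacts [lt_irrefl _ (hCu u h), lt_irrefl _ (hDu u h)]
      · rw [filter_union, filter_true_of_mem hCu,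
          filter_false_of_mem fun d hd => (hDu d hd).not_gt, union_empty, hCi]
      · rw [filter_union, filter_true_of_mem hDu,
          filter_false_of_mem fun d hd => (hCu d hd).not_gt, empty_union, hDj]
    refine ⟨fun h => ?_, fun h => ?_⟩
    · obtain ⟨c, hc, rfl⟩ := hvC h
      simpa using (hall c (mem_union_left _ hc)).2 (hCu c hc)
    · obtain ⟨d, hd, rfl⟩ := hyD h
      have h1 := (hall d (mem_union_right _ hd)).not.2 (hDu d hd).not_gt
      have h2 : u ≠ d := fun h => lt_irrefl _ (h ▸ hDu d hd)
      simpa using lt_of_le_of_ne (not_lt.1 h1) h2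

/-- The case `i = j = 0` has to be excluded: `Π(1, 0)` is empty, but `Tight (pad π) 0 0` says that
`π` is increasing. -/
theorem tight_of_not_hasShuffle {i j : ℕ} (hij : i + j ≠ 0) (hS : ¬ HasShuffle i j π) :
    Tight (pad π) i j := by
  intro v y hvy hv hy u hvu huy
  obtain ⟨h1, h2⟩ := lt_of_not_hasShuffle hS hvy hv hy hvu huy
  have hne1 : v ≠ u := fun h => lt_irrefl _ (h ▸ hvu)
  have hne2 : u ≠ y := fun h => lt_irrefl _ (h ▸ huy)
  rcases Nat.eq_zero_or_pos i with rfl | hi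
  · -- If `u` were to the left of `v`, then `⊥, u` in the role of `v, y` would show the opposite.
    have huy' : u < y := h2 (by omega)
    refine ⟨lt_of_not_ge fun hle => ?_, huy'⟩
    have huv := lt_of_le_of_ne hle hne1.symm
    have hu : Climbs (pad π) (j + 1) u := ⟨y, ⟨huy', huy⟩, hy⟩
    have hbv : (⊥ : WithBot (WithTop (Fin n))) < v := bot_le.trans_lt huv
    rcases eq_or_ne (pad π v) ⊥ with h | h
    · exact hbv.ne (pad_injective π (h.trans (pad_bot π).symm)).symm
    · have h4 : pad π ⊥ < pad π v := bot_lt_iff_ne_bot.2 h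
      have h5 : (⊥ : WithBot (WithTop (Fin n))) < u :=
        bot_lt_iff_ne_bot.2 fun h => by
          rw [h, pad_bot] at hvu
          exact not_lt_bot hvu
      exact lt_asymm huv ((lt_of_not_hasShuffle hS ⟨h5, h4.trans hvu⟩ trivial
        (hu.anti (by omega)) h4 hvu).2 (by omega))
  · have hvu' : v < u := h1 (by omega)
    refine ⟨hvu', ?_⟩
    rcases Nat.eq_zero_or_pos j with rfl | hj
    · refine lt_of_not_ge fun hle => ?_
      have hyu := lt_of_le_of_ne hle hne2.symm
      have hu : Rises (pad π) (i + 1) u := ⟨v, ⟨hvu', hvu⟩, hv⟩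
      have hty : y < (⊤ : WithBot (WithTop (Fin n))) := hyu.trans_le le_top
      have h4 : pad π y < pad π ⊤ := lt_top_iff_ne_top.2 ((pad_injective π).ne hty.ne)
      have h5 : u < (⊤ : WithBot (WithTop (Fin n))) :=
        lt_top_iff_ne_top.2 fun h => by
          rw [h, pad_top] at huy
          exact not_top_lt huy
      exact lt_asymm hyu ((lt_of_not_hasShuffle hS ⟨h5, huy.trans h4⟩ (hu.anti (by omega)) trivial
        huy h4).1 (by omega))
    · exact h2 (by omega)

theorem HasDecreasing.of_isLift {s t m : ℕ} {π' : Equiv.Perm (Fin n)}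
    (hL : IsLift (pad π) s t (pad π')) (h : HasDecreasing m π') : HasDecreasing m π := by
  obtain ⟨D, rfl, hD⟩ := h
  -- The transformed sequence could contain `⊥` or `⊤`, but not if it has two elements.
  rcases le_or_gt #D 1 with h1 | h1
  · refine ⟨D, rfl, fun a ha b hb hab => ?_⟩
    exact absurd (card_le_one.1 h1 a ha b hb) hab.ne
  obtain ⟨E, hE, hE'⟩ := hL.exists_strictAntiOn (D := D.map ⟨entry, entry_injective⟩) (by
    rw [coe_map]
    rintro _ ⟨a, ha, rfl⟩ _ ⟨b, hb, rfl⟩ hab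
    simpa [pad_entry] using hD ha hb (by simpa using hab))
  rw [card_map] at hE
  have hmem : ∀ e ∈ E, ∃ k, entry k = e := by
    intro e he
    obtain ⟨e', he', hne⟩ := exists_mem_ne (hE ▸ h1) e
    induction e using pad_cases with
    | bot => exact absurd (hE' he he' (bot_lt_iff_ne_bot.2 hne)) not_lt_bot
    | top => exact absurd (hE' he' he (lt_top_iff_ne_top.2 hne)) not_top_lt
    | coe k => exact ⟨k, rfl⟩
  refine ⟨E.preimage entry entry_injective.injOn, ?_, ?_⟩
  · rw [← hE, ← card_map ⟨entry, entry_injective⟩]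
    congr 1
    ext e
    simp only [mem_map, mem_preimage, Function.Embedding.coeFn_mk]
    constructor
    · rintro ⟨k, hk, rfl⟩
      exact hk
    · intro he
      obtain ⟨k, rfl⟩ := hmem e he
      exact ⟨k, he, rfl⟩
  · intro a ha b hb hab
    rw [mem_coe, mem_preimage] at ha hb
    simpa [pad_entry] using hE' ha hb (by simpa using hab)

/-- Lifting the heavy entries is an injection from the first set of avoiders to the second. -/
theorem ncard_avoiders_le_step (n m s t : ℕ) :
    (avoiders n m s (t + 1)).ncard ≤ (avoiders n m (s + 1) t).ncard := by
  have hex : ∀ π : Equiv.Perm (Fin n), ∃ π' : Equiv.Perm (Fin n), IsLift (pad π) s t (pad π') :=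
    fun π => exists_lift π s t
  choose F hF using hex
  refine Set.ncard_le_ncard_of_injOn F (fun π h => ⟨?_, fun h' => h.2 (h'.of_isLift (hF π))⟩) ?_
    (Set.toFinite _)
  · exact (hF π).tight.not_hasShuffle
  · intro π₁ h₁ π₂ h₂ heq
    refine perm_eq_of_lt_iff fun k l => ?_
    have e₁ := (hF π₁).lt_iff_lower (pad_injective π₁) (pad_injective (F π₁))
      (tight_of_not_hasShuffle (by omega) h₁.1) (entry k) (entry l)
    have e₂ := (hF π₂).lt_iff_lower (pad_injective π₂) (pad_injective (F π₂))
      (tight_of_not_hasShuffle (by omega) h₂.1) (entry k) (entry l)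
    rw [heq, ← e₂] at e₁
    simpa [pad_entry] using e₁

theorem ncard_avoiders_mono (n m : ℕ) {i j k l : ℕ} (h : i + j = k + l) (hik : i ≤ k) :
    (avoiders n m i j).ncard ≤ (avoiders n m k l).ncard := by
  induction k, hik using Nat.le_induction generalizing l with
  | base =>
    obtain rfl : j = l := by omega
    exact le_rfl
  | succ k _ ih => exact (ih (l := l + 1) (by omega)).trans (ncard_avoiders_le_step n m k l)

/-- The inequalities run from `(0, i + j)` up to `(i + j, 0)`, and the reverse-complement equates
these two ends. -/
theorem ncard_avoiders_eq (n m : ℕ) {i j k l : ℕ} (h : i + j = k + l) :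
    (avoiders n m i j).ncard = (avoiders n m k l).ncard := by
  have key : ∀ {i j k l : ℕ}, i + j = k + l →
      (avoiders n m i j).ncard ≤ (avoiders n m k l).ncard := fun {i j k l} h =>
    calc (avoiders n m i j).ncard ≤ (avoiders n m (i + j) 0).ncard :=
          ncard_avoiders_mono n m (by omega) (by omega)
      _ ≤ (avoiders n m 0 (i + j)).ncard := ncard_avoiders_swap n m _ _
      _ ≤ (avoiders n m k l).ncard := ncard_avoiders_mono n m (by omega) (by omega)
  exact le_antisymm (key h) (key h.symm)

end Padding

end PatternAvoidance

theorem theorem3 (a b c d m : ℕ) (ha : 1 ≤ a) (hc : 1 ≤ c) (hsum : a + b = c + d)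
    (hsize : 2 ≤ a + b) (hm : 1 ≤ m) :
    PatternAvoidance.WilfEquivalent
      (PatternAvoidance.partialShuffle a b ∪ {PatternAvoidance.decreasing m})
      (PatternAvoidance.partialShuffle c d ∪ {PatternAvoidance.decreasing m}) := by
  obtain ⟨i, rfl⟩ : ∃ i, a = i + 1 := ⟨a - 1, by omega⟩
  obtain ⟨k, rfl⟩ : ∃ k, c = k + 1 := ⟨c - 1, by omega⟩
  intro n
  have h := PatternAvoidance.ncard_avoiders_eq n m (i := i) (j := b) (k := k) (l := d) (by omega)
  have e : ∀ i b, PatternAvoidance.Av n (PatternAvoidance.partialShuffle (i + 1) b ∪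
      {PatternAvoidance.decreasing m}) = PatternAvoidance.avoiders n m i b := fun i b =>
    Set.ext fun π => PatternAvoidance.mem_av_iff π
  rw [e, e, h]
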